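/- For $x,y\in\{0,1\}^n$ let $\mathrm{HAM}(x,y)$ be the number of positions in which $x$ and $y$ differ, and let $HAM_n^{(a)}:\{0,1\}^n\times\{0,1\}^n\to\{0,1\}$ be the function with $HAM_n^{(a)}(x,y)=1$ if $\mathrm{HAM}(x,y)\le a$ and $HAM_n^{(a)}(x,y)=0$ otherwise. For $f:\{0,1\}^n\times\{0,1\}^n\to\{0,1\}$, where Alice holds $x$ and Bob holds $y$ and both must know $f(x,y)$ at the end, consider the following worst-case communication costs of optimal error-free protocols. * $D(f)$ is the least number of bits transmitted in a deterministic protocol (the least depth of a protocol tree) computing $f$. * $C^*(f)$ is the least number of classical bits transmitted in a protocol in which Alice and Bob may initially share any finite number of EPR pairs, may perform arbitrary local quantum operations and measurements on finite-dimensional registers, and communicate over a classical channel, such that for all $x,y$ both output $f(x,y)$ with probability $1$. * $Q^*(f)$ is the least number of qubits transmitted in such a protocol when they communicate over a quantum channel instead (one qubit per step, with the sender of each step fixed in advance). Theorem. There is an absolute constant $c>0$ such that for all integers $n,a\ge 0$ with $a\le c\sqrt n$, $$D(HAM_n^{(a)})\ge n,\qquad Q^*(HAM_n^{(a)})\ge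 \frac n2,\qquad C^*(HAM_n^{(a)})\ge n.$$ -/

import Mathlib

open scoped Matrix

noncomputable section

namespace CommComplexity

/-- Bit strings of length `n`. -/
abbrev Bits (n : ℕ) : Type := Fin n → Bool

/-- The function that tells whether the Hamming distance of two strings of length `n`
is at most `a`. -/
def HAM (n a : ℕ) (x y : Bits n) : Bool := decide (hammingDist x y ≤ a)

/-! ### Deterministic protocols -/

/-- A deterministic two-party protocol tree. At an inner node its owner sends one bit, which is
a function of the owner's input (and of the node, that is, of the bits sent so far). A leaf is
labelled with the answer, which is therefore known to both parties. -/
inductive DetProtocol (X Y : Type) : Type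
  | leaf (v : Bool) : DetProtocol X Y
  | alice (msg : X → Bool) (next : Bool → DetProtocol X Y) : DetProtocol X Y
  | bob (msg : Y → Bool) (next : Bool → DetProtocol X Y) : DetProtocol X Y

/-- The answer reached on the inputs `x`, `y`. -/
def DetProtocol.eval {X Y : Type} (x : X) (y : Y) : DetProtocol X Y → Bool
  | .leaf v => v
  | .alice msg next => (next (msg x)).eval x y
  | .bob msg next => (next (msg y)).eval x y

/-- The number of bits transmitted in the worst case: the depth of the tree. -/
def DetProtocol.cost {X Y : Type} : DetProtocol X Y → ℕ
  | .leaf _ => 0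
  | .alice _ next =>
      1 + max (next false).cost (next true).cost
  | .bob _ next =>
      1 + max (next false).cost (next true).cost

/-- The deterministic communication complexity `D(f)`. -/
def D {X Y : Type} (f : X → Y → Bool) : ℕ :=
  sInf {l : ℕ | ∃ p : DetProtocol X Y, (∀ x y, p.eval x y = f x y) ∧ p.cost = l}

/-! ### Joint states, local operations

If Alice's register has the finite set `A` of basis states and Bob's has `B`, a (possibly
unnormalized) joint pure state `∑ ψ a b |a⟩|b⟩` is written as the matrix `ψ : Matrix A B ℂ`.
A linear map `K` applied to Alice's register sends `ψ` to `K * ψ`, and a linear map `L` applied to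
Bob's register sends `ψ` to `ψ * Lᵀ`. -/

/-- The squared Euclidean norm of a joint state. -/
def normSq {A B : Type} [Fintype A] [Fintype B] (ψ : Matrix A B ℂ) : ℝ :=
  ∑ a, ∑ b, ‖ψ a b‖ ^ 2

/-- The state of `k` shared EPR pairs: each party holds one half of every pair, and the state is
`2 ^ (-k/2) ∑ e, |e⟩|e⟩`, the sum being over all bit strings `e` of length `k`. -/
def epr (k : ℕ) : Matrix (Bits k) (Bits k) ℂ :=
  Matrix.of fun e e' => if e = e' then (((Real.sqrt 2)⁻¹ ^ k : ℝ) : ℂ) else 0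

/-- `K false`, `K true` are the operators of a two-outcome quantum measurement that takes a register
with basis `A` to a register with basis `A'`. Outcome `v` on the state `φ` has probability
`‖K v φ‖ ^ 2` and leaves the state `K v φ` (up to normalization). As `A'` is arbitrary, fresh
ancillas, unitary operations and unread measurement results are covered. -/
def IsMeasurement {A A' : Type} [Fintype A'] [DecidableEq A] (K : Bool → Matrix A' A ℂ) : Prop :=
  (K false)ᴴ * K false + (K true)ᴴ * K true = 1

/-- `U` is an isometry from a register with basis `A` to one with basis `A'`, that is, the
adjunction of an ancilla in a fixed state followed by a unitary operation. -/
def IsIsometry {A A' : Type} [Fintype A'] [DecidableEq A] (U : Matrix A' A ℂ) : Prop :=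
  Uᴴ * U = 1

/-! ### Quantum parties, classical channel -/

/-- Protocols over a classical channel for quantum parties that hold registers with bases
`A` (Alice) and `B` (Bob). In a step its sender performs a two-outcome measurement on the own
register, depending on the own input and on the bits exchanged so far, and sends the outcome.
At the end each party measures the own register to get an output bit. -/
inductive EntProtocol (X Y : Type) :
    (A : Type) → [Fintype A] → [DecidableEq A] → (B : Type) → [Fintype B] → [DecidableEq B] → Type 1
  | done {A : Type} [Fintype A] [DecidableEq A] {B : Type} [Fintype B] [DecidableEq B]
      (E : X → Bool → Matrix A A ℂ) (hE : ∀ x, IsMeasurement (E x))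
      (F : Y → Bool → Matrix B B ℂ) (hF : ∀ y, IsMeasurement (F y)) : EntProtocol X Y A B
  | alice {A : Type} [Fintype A] [DecidableEq A] {B : Type} [Fintype B] [DecidableEq B]
      (A' : Type) [Fintype A'] [DecidableEq A']
      (K : X → Bool → Matrix A' A ℂ) (hK : ∀ x, IsMeasurement (K x))
      (next : Bool → EntProtocol X Y A' B) : EntProtocol X Y A B
  | bob {A : Type} [Fintype A] [DecidableEq A] {B : Type} [Fintype B] [DecidableEq B]
      (B' : Type) [Fintype B'] [DecidableEq B']
      (L : Y → Bool → Matrix B' B ℂ) (hL : ∀ y, IsMeasurement (L y))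
      (next : Bool → EntProtocol X Y A B') : EntProtocol X Y A B

/-- The probability, on the inputs `x`, `y` and the initial joint state `ψ`, that both parties
output `v` (for unnormalized `ψ`: this probability times `normSq ψ`). -/
def EntProtocol.prob {X Y : Type} (x : X) (y : Y) (v : Bool) :
    {A : Type} → [Fintype A] → [DecidableEq A] → {B : Type} → [Fintype B] → [DecidableEq B] →
    EntProtocol X Y A B → Matrix A B ℂ → ℝ
  | _, _, _, _, _, _, @EntProtocol.done _ _ _ _ _ _ _ _ E _ F _, ψ =>
      normSq (E x v * ψ * (F y v)ᵀ)
  | _, _, _, _, _, _, @EntProtocol.alice _ _ _ _ _ _ _ _ _ _ _ K _ next, ψ =>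
      ∑ b : Bool, (next b).prob x y v (K x b * ψ)
  | _, _, _, _, _, _, @EntProtocol.bob _ _ _ _ _ _ _ _ _ _ _ L _ next, ψ =>
      ∑ b : Bool, (next b).prob x y v (ψ * (L y b)ᵀ)

/-- The number of bits transmitted in the worst case. -/
def EntProtocol.cost {X Y : Type} :
    {A : Type} → [Fintype A] → [DecidableEq A] → {B : Type} → [Fintype B] → [DecidableEq B] →
    EntProtocol X Y A B → ℕ
  | _, _, _, _, _, _, @EntProtocol.done _ _ _ _ _ _ _ _ _ _ _ _ => 0
  | _, _, _, _, _, _, @EntProtocol.alice _ _ _ _ _ _ _ _ _ _ _ _ _ next =>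
      1 + max (next false).cost (next true).cost
  | _, _, _, _, _, _, @EntProtocol.bob _ _ _ _ _ _ _ _ _ _ _ _ _ next =>
      1 + max (next false).cost (next true).cost

/-- The complexity `C*(f)`: the least number of classical bits in an error-free protocol of quantum
parties that share EPR pairs, as many as the protocol wants. -/
def Cstar {X Y : Type} (f : X → Y → Bool) : ℕ :=
  sInf {l : ℕ | ∃ (k : ℕ) (p : EntProtocol X Y (Bits k) (Bits k)),
    (∀ x y, p.prob x y (f x y) (epr k) = 1) ∧ p.cost = l}

/-! ### Quantum parties, quantum channel -/

/-- Protocols over a quantum channel for parties that hold registers with bases `A` and `B`.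
In a step its sender applies to the own register an isometry, depending on the own input, whose
result consists of a new register and one qubit, and sends the qubit, which thereby joins the
register of the receiver. At the end each party measures the own register to get an output bit. -/
inductive QProtocol (X Y : Type) :
    (A : Type) → [Fintype A] → [DecidableEq A] → (B : Type) → [Fintype B] → [DecidableEq B] → Type 1
  | done {A : Type} [Fintype A] [DecidableEq A] {B : Type} [Fintype B] [DecidableEq B]
      (E : X → Bool → Matrix A A ℂ) (hE : ∀ x, IsMeasurement (E x))
      (F : Y → Bool → Matrix B B ℂ) (hF : ∀ y, IsMeasurement (F y)) : QProtocol X Y A B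
  | alice {A : Type} [Fintype A] [DecidableEq A] {B : Type} [Fintype B] [DecidableEq B]
      (A' : Type) [Fintype A'] [DecidableEq A']
      (U : X → Matrix (A' × Bool) A ℂ) (hU : ∀ x, IsIsometry (U x))
      (next : QProtocol X Y A' (B × Bool)) : QProtocol X Y A B
  | bob {A : Type} [Fintype A] [DecidableEq A] {B : Type} [Fintype B] [DecidableEq B]
      (B' : Type) [Fintype B'] [DecidableEq B']
      (V : Y → Matrix (B' × Bool) B ℂ) (hV : ∀ y, IsIsometry (V y))
      (next : QProtocol X Y (A × Bool) B') : QProtocol X Y A B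

/-- Alice hands a qubit over to Bob. -/
def toBob {A B : Type} (φ : Matrix (A × Bool) B ℂ) : Matrix A (B × Bool) ℂ :=
  Matrix.of fun a bc => φ (a, bc.2) bc.1

/-- Bob hands a qubit over to Alice. -/
def toAlice {A B : Type} (φ : Matrix A (B × Bool) ℂ) : Matrix (A × Bool) B ℂ :=
  Matrix.of fun ac b => φ ac.1 (b, ac.2)

/-- The probability, on the inputs `x`, `y` and the initial joint state `ψ`, that both parties
output `v` (for unnormalized `ψ`: this probability times `normSq ψ`). -/
def QProtocol.prob {X Y : Type} (x : X) (y : Y) (v : Bool) :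
    {A : Type} → [Fintype A] → [DecidableEq A] → {B : Type} → [Fintype B] → [DecidableEq B] →
    QProtocol X Y A B → Matrix A B ℂ → ℝ
  | _, _, _, _, _, _, @QProtocol.done _ _ _ _ _ _ _ _ E _ F _, ψ =>
      normSq (E x v * ψ * (F y v)ᵀ)
  | _, _, _, _, _, _, @QProtocol.alice _ _ _ _ _ _ _ _ _ _ _ U _ next, ψ =>
      next.prob x y v (toBob (U x * ψ))
  | _, _, _, _, _, _, @QProtocol.bob _ _ _ _ _ _ _ _ _ _ _ V _ next, ψ =>
      next.prob x y v (toAlice (ψ * (V y)ᵀ))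

/-- The number of qubits transmitted. -/
def QProtocol.cost {X Y : Type} :
    {A : Type} → [Fintype A] → [DecidableEq A] → {B : Type} → [Fintype B] → [DecidableEq B] →
    QProtocol X Y A B → ℕ
  | _, _, _, _, _, _, @QProtocol.done _ _ _ _ _ _ _ _ _ _ _ _ => 0
  | _, _, _, _, _, _, @QProtocol.alice _ _ _ _ _ _ _ _ _ _ _ _ _ next => 1 + next.cost
  | _, _, _, _, _, _, @QProtocol.bob _ _ _ _ _ _ _ _ _ _ _ _ _ next => 1 + next.cost

/-- The complexity `Q*(f)`: the least number of qubits in an error-free protocol over a quantum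
channel of parties that share EPR pairs, as many as the protocol wants. -/
def Qstar {X Y : Type} (f : X → Y → Bool) : ℕ :=
  sInf {l : ℕ | ∃ (k : ℕ) (p : QProtocol X Y (Bits k) (Bits k)),
    (∀ x y, p.prob x y (f x y) (epr k) = 1) ∧ p.cost = l}

end CommComplexity

end

open scoped Matrix

noncomputable section

namespace CommComplexity

/-! The bounds come from the rank of the communication matrix. Pulling the final measurement back
through an error-free protocol gives operators `∑ i, M i x ⊗ N i y` that fix states accepted with
certainty and kill states rejected with certainty. A classical bit at most doubles the number of
terms and a qubit at most quadruples it (`EntProtocol.hasAcceptanceRankLE`,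
`QProtocol.hasAcceptanceRankLE`).

The EPR state is a multiple of the identity matrix, so correctness says `∑ i, M i x * (N i y)ᵀ =
f(x,y) • 1`. Hence `f ⊗ 1` on dimension `2 ^ k` factors through `ι × Bits k`. The factor `2 ^ k`
cancels, and the number of terms is at least the rank of `f`, however many pairs are shared
(`HasAcceptanceRankLE.card_le`).

The matrix of `HAM` depends only on `x xor y`, so the characters are eigenvectors. The eigenvalue at
a set `s` is a polynomial of degree `a` in `s.card`. It vanishes on at most `a` layers of the cube,
each of size at most `n.choose (n / 2) ≤ 2 ^ n / √(n + 1)`. For `4 * a ^ 2 ≤ n` the rank thus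
exceeds `2 ^ n / 2`, whence `Cstar ≥ n` and `2 * Qstar ≥ n`; the bound on `D` follows from `Cstar ≤
D`. -/

/-! ### Norms of joint states under measurements and isometries -/

lemma normSq_nonneg {A B : Type} [Fintype A] [Fintype B] (ψ : Matrix A B ℂ) : 0 ≤ normSq ψ := by
  unfold normSq; positivity

lemma eq_zero_of_normSq_eq_zero {A B : Type} [Fintype A] [Fintype B] {ψ : Matrix A B ℂ}
    (h : normSq ψ = 0) : ψ = 0 := by
  unfold normSq at h
  ext a b
  rw [Finset.sum_eq_zero_iff_of_nonneg (fun _ _ => by positivity)] at h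
  have h1 := h a (Finset.mem_univ a)
  rw [Finset.sum_eq_zero_iff_of_nonneg (fun _ _ => by positivity)] at h1
  simpa using h1 b (Finset.mem_univ b)

lemma normSq_transpose {A B : Type} [Fintype A] [Fintype B] (ψ : Matrix A B ℂ) :
    normSq ψᵀ = normSq ψ := by
  unfold normSq
  exact Finset.sum_comm

lemma normSq_eq_trace {A B : Type} [Fintype A] [Fintype B] (ψ : Matrix A B ℂ) :
    (normSq ψ : ℂ) = (ψᴴ * ψ).trace := by
  simp only [normSq, Matrix.trace, Matrix.diag, Matrix.mul_apply, Matrix.conjTranspose_apply]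
  rw [Finset.sum_comm]
  push_cast
  refine Finset.sum_congr rfl fun b _ => Finset.sum_congr rfl fun a _ => ?_
  rw [← Complex.conj_mul']
  rfl

section
variable {A A' B B' C : Type} [Fintype A] [Fintype A'] [Fintype B] [Fintype B']

lemma IsMeasurement.normSq_add [DecidableEq A] {K : Bool → Matrix A' A ℂ} (hK : IsMeasurement K)
    (ψ : Matrix A B ℂ) : normSq (K false * ψ) + normSq (K true * ψ) = normSq ψ := by
  have h : ((normSq (K false * ψ) + normSq (K true * ψ) : ℝ) : ℂ) = (normSq ψ : ℂ) := by
    push_cast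
    simp only [normSq_eq_trace]
    rw [← Matrix.trace_add, Matrix.conjTranspose_mul, Matrix.conjTranspose_mul]
    have : ψᴴ * (K false)ᴴ * (K false * ψ) + ψᴴ * (K true)ᴴ * (K true * ψ)
        = ψᴴ * (((K false)ᴴ * K false + (K true)ᴴ * K true) * ψ) := by
      simp only [Matrix.mul_assoc, Matrix.add_mul, Matrix.mul_add]
    rw [this, hK, Matrix.one_mul]
  exact_mod_cast h

lemma IsMeasurement.normSq_add_right [DecidableEq B] {L : Bool → Matrix B' B ℂ} (hL : IsMeasurement L)
    (ψ : Matrix A B ℂ) : normSq (ψ * (L false)ᵀ) + normSq (ψ * (L true)ᵀ) = normSq ψ := by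
  have h := hL.normSq_add ψᵀ
  rw [← normSq_transpose (L false * ψᵀ), ← normSq_transpose (L true * ψᵀ), normSq_transpose ψ] at h
  simpa [Matrix.transpose_mul] using h

lemma IsMeasurement.reconstruct [DecidableEq A] {K : Bool → Matrix A' A ℂ} (hK : IsMeasurement K)
    (ψ : Matrix A C ℂ) : (K false)ᴴ * (K false * ψ) + (K true)ᴴ * (K true * ψ) = ψ := by
  rw [← Matrix.mul_assoc, ← Matrix.mul_assoc, ← Matrix.add_mul, hK, Matrix.one_mul]

lemma IsMeasurement.reconstruct_right [DecidableEq B] {L : Bool → Matrix B' B ℂ} (hL : IsMeasurement L)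
    (ψ : Matrix C B ℂ) :
    ψ * (L false)ᵀ * ((L false)ᴴ)ᵀ + ψ * (L true)ᵀ * ((L true)ᴴ)ᵀ = ψ := by
  have h := congrArg Matrix.transpose (hL.reconstruct ψᵀ)
  simpa [Matrix.transpose_mul, Matrix.mul_assoc] using h

lemma IsIsometry.normSq_mul [DecidableEq A] {U : Matrix A' A ℂ} (hU : IsIsometry U) (ψ : Matrix A B ℂ) :
    normSq (U * ψ) = normSq ψ := by
  have h : ((normSq (U * ψ) : ℝ) : ℂ) = (normSq ψ : ℂ) := by
    simp only [normSq_eq_trace]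
    rw [Matrix.conjTranspose_mul, Matrix.mul_assoc, ← Matrix.mul_assoc Uᴴ, hU, Matrix.one_mul]
  exact_mod_cast h

lemma IsIsometry.normSq_mul_right [DecidableEq B] {V : Matrix B' B ℂ} (hV : IsIsometry V) (ψ : Matrix A B ℂ) :
    normSq (ψ * Vᵀ) = normSq ψ := by
  have h := hV.normSq_mul ψᵀ
  rw [← normSq_transpose, normSq_transpose ψ] at h
  simpa [Matrix.transpose_mul] using h

lemma IsIsometry.reconstruct [DecidableEq A] {U : Matrix A' A ℂ} (hU : IsIsometry U) (ψ : Matrix A C ℂ) :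
    Uᴴ * (U * ψ) = ψ := by
  rw [← Matrix.mul_assoc, hU, Matrix.one_mul]

lemma IsIsometry.reconstruct_right [DecidableEq B] {V : Matrix B' B ℂ} (hV : IsIsometry V) (ψ : Matrix C B ℂ) :
    ψ * Vᵀ * (Vᴴ)ᵀ = ψ := by
  have h := congrArg Matrix.transpose (hV.reconstruct ψᵀ)
  simpa [Matrix.transpose_mul, Matrix.mul_assoc] using h

/-- If the joint outcome `(v, v)` is certain, then so is Alice's outcome `v`. -/
lemma IsMeasurement.mul_eq_zero_of_certain [DecidableEq A] [DecidableEq B]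
    {E : Bool → Matrix A' A ℂ} {F : Bool → Matrix B' B ℂ}
    (hE : IsMeasurement E) (hF : IsMeasurement F) {ψ : Matrix A B ℂ} (v : Bool)
    (h : normSq (E v * ψ * (F v)ᵀ) = normSq ψ) : E (!v) * ψ = 0 ∧ ψ * (F (!v))ᵀ = 0 := by
  -- The joint outcomes split the squared norm into nonnegative parts; if `(v, v)` takes all of it,
  -- the others vanish.
  have h1 := hE.normSq_add ψ
  have h2 := hF.normSq_add_right (E v * ψ)
  have h3 := hF.normSq_add_right ψ
  have h4 := hE.normSq_add (ψ * (F v)ᵀ)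
  have n1 := normSq_nonneg (E (!v) * ψ)
  have n2 := normSq_nonneg (ψ * (F (!v))ᵀ)
  have n3 := normSq_nonneg (E v * ψ * (F (!v))ᵀ)
  have n4 := normSq_nonneg (E (!v) * (ψ * (F v)ᵀ))
  rw [Matrix.mul_assoc] at h
  constructor <;> apply eq_zero_of_normSq_eq_zero <;> cases v <;>
    simp only [Bool.not_true, Bool.not_false, Matrix.mul_assoc] at * <;> linarith

end

lemma normSq_toBob {A B : Type} [Fintype A] [Fintype B] (φ : Matrix (A × Bool) B ℂ) :
    normSq (toBob φ) = normSq φ := by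
  simp only [normSq, toBob, Fintype.sum_prod_type, Matrix.of_apply]
  exact Finset.sum_congr rfl fun a _ => Finset.sum_comm

lemma normSq_toAlice {A B : Type} [Fintype A] [Fintype B] (φ : Matrix A (B × Bool) ℂ) :
    normSq (toAlice φ) = normSq φ := by
  rw [← normSq_toBob]; rfl

lemma toAlice_toBob {A B : Type} (φ : Matrix (A × Bool) B ℂ) : toAlice (toBob φ) = φ := rfl

lemma toBob_toAlice {A B : Type} (φ : Matrix A (B × Bool) ℂ) : toBob (toAlice φ) = φ := rfl

/-! ### Acceptance operators of protocols -/

section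
variable {X Y : Type}

lemma EntProtocol.prob_le (x : X) (y : Y) (v : Bool) {A : Type} [Fintype A] [DecidableEq A]
    {B : Type} [Fintype B] [DecidableEq B] (p : EntProtocol X Y A B) (ψ : Matrix A B ℂ) :
    p.prob x y v ψ ≤ normSq ψ := by
  induction p with
  | done E hE F hF =>
    have h1 := (hE x).normSq_add ψ
    have h2 := (hF y).normSq_add_right (E x v * ψ)
    have n1 := normSq_nonneg (E x (!v) * ψ)
    have n3 := normSq_nonneg (E x v * ψ * (F y (!v))ᵀ)
    simp only [EntProtocol.prob]
    cases v <;> simp only [Bool.not_true, Bool.not_false] at * <;> linarith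
  | alice A' K hK next ih =>
    simp only [EntProtocol.prob, Fintype.sum_bool]
    linarith [(hK x).normSq_add ψ, ih false (K x false * ψ), ih true (K x true * ψ)]
  | bob B' L hL next ih =>
    simp only [EntProtocol.prob, Fintype.sum_bool]
    linarith [(hL y).normSq_add_right ψ, ih false (ψ * (L y false)ᵀ), ih true (ψ * (L y true)ᵀ)]

/-- There are operators `∑ i, M i x ⊗ N i y`, with at most `r` terms, that fix each joint state on
which the outcome `true` is certain and annihilate each joint state on which the outcome `false` is
certain, where `P x y v ψ` is the probability of the outcome `v` on the state `ψ`. -/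
def HasAcceptanceRankLE {A B : Type} [Fintype A] [Fintype B]
    (P : X → Y → Bool → Matrix A B ℂ → ℝ) (r : ℕ) : Prop :=
  ∃ (ι : Type) (_ : Fintype ι) (M : ι → X → Matrix A A ℂ) (N : ι → Y → Matrix B B ℂ),
    Fintype.card ι ≤ r ∧ ∀ x y ψ,
      (P x y true ψ = normSq ψ → ∑ i, M i x * ψ * (N i y)ᵀ = ψ) ∧
      (P x y false ψ = normSq ψ → ∑ i, M i x * ψ * (N i y)ᵀ = 0)

/-- The operator is `EᴴE ⊗ FᴴF` for the outcome `true`. If `true` is certain, the `false` parts of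
the state vanish on both sides, so `EᴴE` and `FᴴF` each fix it; if `false` is certain, Alice's `E
true` already kills it. -/
lemma hasAcceptanceRankLE_measure {A B : Type} [Fintype A] [DecidableEq A] [Fintype B]
    [DecidableEq B] (E : X → Bool → Matrix A A ℂ) (hE : ∀ x, IsMeasurement (E x))
    (F : Y → Bool → Matrix B B ℂ) (hF : ∀ y, IsMeasurement (F y)) :
    HasAcceptanceRankLE (fun x y v (ψ : Matrix A B ℂ) => normSq (E x v * ψ * (F y v)ᵀ)) 1 := by
  refine ⟨Unit, inferInstance, fun _ x => (E x true)ᴴ * E x true,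
    fun _ y => (F y true)ᴴ * F y true, by simp, fun x y ψ => ⟨fun h => ?_, fun h => ?_⟩⟩
  · obtain ⟨h1, h2⟩ := (hE x).mul_eq_zero_of_certain (hF y) true h
    have h3 := (hE x).reconstruct ψ
    have h4 := (hF y).reconstruct_right ψ
    simp only [Bool.not_true] at h1 h2
    simp only [h1, Matrix.mul_zero, zero_add] at h3
    simp only [h2, Matrix.zero_mul, zero_add] at h4
    simp only [Finset.univ_unique, Finset.sum_const, Finset.card_singleton, one_smul,
      Matrix.transpose_mul]
    rw [Matrix.mul_assoc ((E x true)ᴴ), h3, ← Matrix.mul_assoc, h4]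
  · obtain ⟨h1, -⟩ := (hE x).mul_eq_zero_of_certain (hF y) false h
    simp only [Bool.not_false] at h1
    simp [Matrix.mul_assoc _ _ ψ, h1]

/-- The operators of the two branches, conjugated by the measurement operators of the step, are
added, and so are their numbers of terms. -/
lemma EntProtocol.hasAcceptanceRankLE {A : Type} [Fintype A] [DecidableEq A]
    {B : Type} [Fintype B] [DecidableEq B] (p : EntProtocol X Y A B) :
    HasAcceptanceRankLE (fun x y v ψ => p.prob x y v ψ) (2 ^ p.cost) := by
  induction p with
  | done E hE F hF => exact hasAcceptanceRankLE_measure E hE F hF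
  | alice A' K hK next ih =>
    choose ι hι M N hc h using ih
    refine ⟨Σ b, ι b, inferInstance, fun i x => (K x i.1)ᴴ * M i.1 i.2 x * K x i.1,
      fun i y => N i.1 i.2 y, ?_, fun x y ψ => ?_⟩
    · simp only [Fintype.card_sigma, Fintype.sum_bool, EntProtocol.cost]
      have h0 := (hc false).trans (Nat.pow_le_pow_right two_pos (le_max_left _ (next true).cost))
      have h1 := (hc true).trans (Nat.pow_le_pow_right two_pos (le_max_right (next false).cost _))
      rw [pow_add]; omega
    · have key : ∑ i : Σ b, ι b, (K x i.1)ᴴ * M i.1 i.2 x * K x i.1 * ψ * (N i.1 i.2 y)ᵀ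
          = ∑ b, (K x b)ᴴ * ∑ i, M b i x * (K x b * ψ) * (N b i y)ᵀ := by
        simp only [Fintype.sum_sigma, Matrix.mul_sum, Matrix.mul_assoc]
      have hsum := (hK x).normSq_add ψ
      -- No branch exceeds its own squared norm, so certainty overall forces certainty in each
      -- branch, and the induction hypothesis applies to both.
      have l := fun v b => EntProtocol.prob_le x y v (next b) (K x b * ψ)
      simp only [EntProtocol.prob, Fintype.sum_bool, key]
      refine ⟨fun hp => ?_, fun hp => ?_⟩
      · rw [(h false x y (K x false * ψ)).1 (by linarith [l true false, l true true]),
          (h true x y (K x true * ψ)).1 (by linarith [l true false, l true true]), add_comm]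
        exact (hK x).reconstruct ψ
      · rw [(h false x y (K x false * ψ)).2 (by linarith [l false false, l false true]),
          (h true x y (K x true * ψ)).2 (by linarith [l false false, l false true])]
        simp
  | bob B' L hL next ih =>
    choose ι hι M N hc h using ih
    refine ⟨Σ b, ι b, inferInstance, fun i x => M i.1 i.2 x,
      fun i y => (L y i.1)ᴴ * N i.1 i.2 y * L y i.1, ?_, fun x y ψ => ?_⟩
    · simp only [Fintype.card_sigma, Fintype.sum_bool, EntProtocol.cost]
      have h0 := (hc false).trans (Nat.pow_le_pow_right two_pos (le_max_left _ (next true).cost))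
      have h1 := (hc true).trans (Nat.pow_le_pow_right two_pos (le_max_right (next false).cost _))
      rw [pow_add]; omega
    · have key : ∑ i : Σ b, ι b, M i.1 i.2 x * ψ * ((L y i.1)ᴴ * N i.1 i.2 y * L y i.1)ᵀ
          = ∑ b, (∑ i, M b i x * (ψ * (L y b)ᵀ) * (N b i y)ᵀ) * ((L y b)ᴴ)ᵀ := by
        simp only [Fintype.sum_sigma, Matrix.sum_mul, Matrix.mul_assoc, Matrix.transpose_mul]
      have hsum := (hL y).normSq_add_right ψ
      have l := fun v b => EntProtocol.prob_le x y v (next b) (ψ * (L y b)ᵀ)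
      simp only [EntProtocol.prob, Fintype.sum_bool, key]
      refine ⟨fun hp => ?_, fun hp => ?_⟩
      · rw [(h false x y _).1 (by linarith [l true false, l true true]),
          (h true x y _).1 (by linarith [l true false, l true true]), add_comm]
        exact (hL y).reconstruct_right ψ
      · rw [(h false x y _).2 (by linarith [l false false, l false true]),
          (h true x y _).2 (by linarith [l false false, l false true])]
        simp

/-- Expanding `N` in the four matrix units of the transferred qubit makes it a sum of products
across the old division of the registers. This is the source of the factor 4 per qubit. -/
lemma toAlice_mul_toBob_mul {A B : Type} [Fintype A] [Fintype B] (M : Matrix A A ℂ)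
    (N : Matrix (B × Bool) (B × Bool) ℂ) (φ : Matrix (A × Bool) B ℂ) :
    toAlice (M * toBob φ * Nᵀ) = ∑ c : Bool × Bool,
      Matrix.kronecker M (Matrix.single c.1 c.2 1) * φ *
        (Matrix.of fun b b' => N (b, c.1) (b', c.2))ᵀ := by
  ext ⟨a, c⟩ b
  cases c <;>
  simp [toAlice, toBob, Matrix.mul_apply, Fintype.sum_prod_type, Matrix.sum_apply,
    Matrix.single_apply, Finset.sum_add_distrib, add_mul]

lemma toBob_mul_toAlice_mul {A B : Type} [Fintype A] [Fintype B]
    (M : Matrix (A × Bool) (A × Bool) ℂ) (N : Matrix B B ℂ) (φ : Matrix A (B × Bool) ℂ) :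
    toBob (M * toAlice φ * Nᵀ) = ∑ c : Bool × Bool,
      (Matrix.of fun a a' => M (a, c.1) (a', c.2)) * φ *
        (Matrix.kronecker N (Matrix.single c.1 c.2 1))ᵀ := by
  ext a ⟨b, c⟩
  cases c <;>
  simp [toAlice, toBob, Matrix.mul_apply, Fintype.sum_prod_type, Matrix.sum_apply,
    Matrix.single_apply, Finset.sum_add_distrib, add_mul]

lemma toAlice_sum {ι A B : Type} [Fintype ι] (φ : ι → Matrix A (B × Bool) ℂ) :
    toAlice (∑ i, φ i) = ∑ i, toAlice (φ i) := by
  ext a b; simp [toAlice, Matrix.sum_apply]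

lemma toBob_sum {ι A B : Type} [Fintype ι] (φ : ι → Matrix (A × Bool) B ℂ) :
    toBob (∑ i, φ i) = ∑ i, toBob (φ i) := by
  ext a b; simp [toBob, Matrix.sum_apply]

lemma QProtocol.hasAcceptanceRankLE {A : Type} [Fintype A] [DecidableEq A]
    {B : Type} [Fintype B] [DecidableEq B] (p : QProtocol X Y A B) :
    HasAcceptanceRankLE (fun x y v ψ => p.prob x y v ψ) (4 ^ p.cost) := by
  induction p with
  | done E hE F hF => exact hasAcceptanceRankLE_measure E hE F hF
  | alice A' U hU next ih =>
    obtain ⟨ι, hι, M, N, hc, h⟩ := ih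
    refine ⟨ι × Bool × Bool, inferInstance,
      fun i x => (U x)ᴴ * Matrix.kronecker (M i.1 x) (Matrix.single i.2.1 i.2.2 1) * U x,
      fun i y => Matrix.of fun b b' => N i.1 y (b, i.2.1) (b', i.2.2), ?_, fun x y ψ => ?_⟩
    · simp only [Fintype.card_prod, Fintype.card_bool, QProtocol.cost, pow_add]
      omega
    · have key : ∑ i : ι × Bool × Bool,
          (U x)ᴴ * Matrix.kronecker (M i.1 x) (Matrix.single i.2.1 i.2.2 1) * U x * ψ *
            (Matrix.of fun b b' => N i.1 y (b, i.2.1) (b', i.2.2))ᵀ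
          = (U x)ᴴ * toAlice (∑ i, M i x * toBob (U x * ψ) * (N i y)ᵀ) := by
        rw [Fintype.sum_prod_type, toAlice_sum, Matrix.mul_sum]
        refine Finset.sum_congr rfl fun i _ => ?_
        rw [toAlice_mul_toBob_mul, Matrix.mul_sum]
        simp only [Matrix.mul_assoc]
      simp only [QProtocol.prob, key]
      have hn : normSq ψ = normSq (toBob (U x * ψ)) := by
        rw [normSq_toBob, (hU x).normSq_mul]
      refine ⟨fun hp => ?_, fun hp => ?_⟩
      · rw [(h x y _).1 (hp.trans hn), toAlice_toBob, (hU x).reconstruct]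
      · rw [(h x y _).2 (hp.trans hn)]
        exact Matrix.mul_zero _
  | bob B' V hV next ih =>
    obtain ⟨ι, hι, M, N, hc, h⟩ := ih
    refine ⟨ι × Bool × Bool, inferInstance,
      fun i x => Matrix.of fun b b' => M i.1 x (b, i.2.1) (b', i.2.2),
      fun i y => (V y)ᴴ * Matrix.kronecker (N i.1 y) (Matrix.single i.2.1 i.2.2 1) * V y,
      ?_, fun x y ψ => ?_⟩
    · simp only [Fintype.card_prod, Fintype.card_bool, QProtocol.cost, pow_add]
      omega
    · have key : ∑ i : ι × Bool × Bool,
          (Matrix.of fun b b' => M i.1 x (b, i.2.1) (b', i.2.2)) * ψ *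
            ((V y)ᴴ * Matrix.kronecker (N i.1 y) (Matrix.single i.2.1 i.2.2 1) * V y)ᵀ
          = toBob (∑ i, M i x * toAlice (ψ * (V y)ᵀ) * (N i y)ᵀ) * ((V y)ᴴ)ᵀ := by
        rw [Fintype.sum_prod_type, toBob_sum, Matrix.sum_mul]
        refine Finset.sum_congr rfl fun i _ => ?_
        rw [toBob_mul_toAlice_mul, Matrix.sum_mul]
        simp only [Matrix.mul_assoc, Matrix.transpose_mul]
      simp only [QProtocol.prob, key]
      have hn : normSq ψ = normSq (toAlice (ψ * (V y)ᵀ)) := by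
        rw [normSq_toAlice, (hV y).normSq_mul_right]
      refine ⟨fun hp => ?_, fun hp => ?_⟩
      · rw [(h x y _).1 (hp.trans hn), toBob_toAlice, (hV y).reconstruct_right]
      · rw [(h x y _).2 (hp.trans hn)]
        exact Matrix.zero_mul _

/-! ### The rank bound from EPR pairs -/

lemma epr_eq_smul_one (k : ℕ) : epr k = (((Real.sqrt 2)⁻¹ ^ k : ℝ) : ℂ) • 1 := by
  ext e e'; simp [epr, Matrix.one_apply]

lemma normSq_epr (k : ℕ) : normSq (epr k) = 1 := by
  have h : ∀ e : Bits k, ∑ e' : Bits k, ‖epr k e e'‖ ^ 2 = (2 ^ k : ℝ)⁻¹ := by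
    intro e
    rw [Finset.sum_eq_single e]
    · simp only [epr, Matrix.of_apply, if_true, Complex.norm_real, Real.norm_eq_abs, sq_abs]
      rw [← pow_mul, mul_comm, pow_mul, inv_pow, Real.sq_sqrt (by norm_num), inv_pow]
    · intro e' _ h
      simp [epr, h.symm]
    · simp
  simp [normSq, h]

/-- A matrix `g` with a nonsingular compression of size `S` cannot be computed from maximally
entangled pairs by acceptance operators of rank less than the size of `S`. -/
lemma HasAcceptanceRankLE.card_le [Fintype X] [Fintype Y] {S : Type} [Fintype S] [DecidableEq S]
    {k r : ℕ} {P : X → Y → Bool → Matrix (Bits k) (Bits k) ℂ → ℝ} (hP : HasAcceptanceRankLE P r)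
    {g : X → Y → Bool} (hg : ∀ x y, P x y (g x y) (epr k) = 1)
    (p : S → X → ℂ) (q : Y → S → ℂ)
    (hpq : ∀ s t, ∑ x, ∑ y, p s x * (if g x y then 1 else 0) * q y t = if s = t then 1 else 0) :
    Fintype.card S ≤ r := by
  obtain ⟨ι, hι, M, N, hc, h⟩ := hP
  refine le_trans ?_ hc
  have hMN : ∀ x y, ∑ i, M i x * (N i y)ᵀ = (if g x y then (1 : ℂ) else 0) • 1 := by
    intro x y
    have hc0 : (((Real.sqrt 2)⁻¹ ^ k : ℝ) : ℂ) ≠ 0 := by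
      have : (0 : ℝ) < (Real.sqrt 2)⁻¹ ^ k := by positivity
      exact_mod_cast this.ne'
    have hgxy := hg x y
    rw [← normSq_epr k] at hgxy
    have h1 : ∑ i, M i x * epr k * (N i y)ᵀ
        = (((Real.sqrt 2)⁻¹ ^ k : ℝ) : ℂ) • ∑ i, M i x * (N i y)ᵀ := by
      rw [epr_eq_smul_one, Finset.smul_sum]
      simp only [Matrix.mul_smul, Matrix.smul_mul, Matrix.mul_one]
    apply smul_right_injective _ hc0
    dsimp only
    rw [← h1]
    cases hv : g x y
    · rw [hv] at hgxy
      rw [(h x y _).2 hgxy]; simp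
    · rw [hv] at hgxy
      rw [(h x y _).1 hgxy, epr_eq_smul_one]; simp
  -- `C` and `B` are the block matrices of the `M i x` and of the `(N i y)ᵀ`, compressed by `p` and
  -- `q`; their product is the compression of `g`, tensored with the identity.
  let C : Matrix (S × Bits k) (ι × Bits k) ℂ :=
    Matrix.of fun a b => ∑ x, p a.1 x * M b.1 x a.2 b.2
  let B : Matrix (ι × Bits k) (S × Bits k) ℂ :=
    Matrix.of fun a b => ∑ y, q y b.1 * (N a.1 y)ᵀ a.2 b.2
  have hCB : C * B = 1 := by
    ext ⟨s, d⟩ ⟨t, e⟩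
    have h2 : ∀ x y, ∑ i, ∑ c, M i x d c * (N i y)ᵀ c e
        = (if g x y then 1 else 0) * (1 : Matrix (Bits k) (Bits k) ℂ) d e := by
      intro x y
      have := congrFun (congrFun (hMN x y) d) e
      simpa only [Matrix.sum_apply, Matrix.mul_apply, Matrix.smul_apply, smul_eq_mul] using this
    calc (C * B) (s, d) (t, e)
        = ∑ i, ∑ c, ∑ x, ∑ y, p s x * q y t * (M i x d c * (N i y)ᵀ c e) := by
          simp only [C, B, Matrix.mul_apply, Matrix.of_apply, Fintype.sum_prod_type,
            Finset.sum_mul_sum]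
          refine Finset.sum_congr rfl fun i _ => Finset.sum_congr rfl fun c _ =>
            Finset.sum_congr rfl fun x _ => Finset.sum_congr rfl fun y _ => ?_
          ring
      _ = ∑ x, ∑ y, p s x * q y t * ∑ i, ∑ c, M i x d c * (N i y)ᵀ c e := by
          simp only [Finset.mul_sum]
          rw [Finset.sum_congr rfl fun i _ => Finset.sum_comm, Finset.sum_comm]
          refine Finset.sum_congr rfl fun x _ => ?_
          rw [Finset.sum_congr rfl fun i _ => Finset.sum_comm, Finset.sum_comm]
      _ = (∑ x, ∑ y, p s x * (if g x y then 1 else 0) * q y t)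
            * (1 : Matrix (Bits k) (Bits k) ℂ) d e := by
          simp only [h2, Finset.sum_mul]
          refine Finset.sum_congr rfl fun x _ => Finset.sum_congr rfl fun y _ => ?_
          ring
      _ = (1 : Matrix (S × Bits k) (S × Bits k) ℂ) (s, d) (t, e) := by
          rw [hpq]
          simp only [Matrix.one_apply, Prod.mk.injEq, ite_and]
          split_ifs <;> simp
  have hr : Fintype.card (S × Bits k) ≤ Fintype.card (ι × Bits k) := by
    calc Fintype.card (S × Bits k) = (C * B).rank := by rw [hCB, Matrix.rank_one]
      _ ≤ C.rank := Matrix.rank_mul_le_left _ _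
      _ ≤ _ := Matrix.rank_le_card_width _
  rw [Fintype.card_prod, Fintype.card_prod] at hr
  exact Nat.le_of_mul_le_mul_right hr Fintype.card_pos

end

/-! ### Existence of protocols -/

section
variable {X Y : Type}

/-- Alice sends all her bits and Bob returns the answer. Some protocol must be exhibited because
`sInf ∅ = 0` would falsify the lower bounds. -/
lemma exists_detProtocol_of_sent (l : ℕ) (m : Fin l → X → Bool)
    (h : Y → (Fin l → Bool) → Bool) :
    ∃ p : DetProtocol X Y, ∀ x y, p.eval x y = h y fun i => m i x := by
  induction l with
  | zero =>
    refine ⟨.bob (fun y => h y Fin.elim0) .leaf, fun x y => ?_⟩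
    simp only [DetProtocol.eval]
    congr 1; ext i; exact i.elim0
  | succ l ih =>
    choose p hp using fun b : Bool => ih (fun i => m i.succ) fun y z => h y (Fin.cons b z)
    refine ⟨.alice (m 0) p, fun x y => ?_⟩
    simp only [DetProtocol.eval, hp]
    congr 1; ext i
    refine Fin.cases ?_ (fun j => ?_) i <;> simp

lemma exists_detProtocol {n : ℕ} (f : Bits n → Y → Bool) :
    ∃ p : DetProtocol (Bits n) Y, ∀ x y, p.eval x y = f x y :=
  exists_detProtocol_of_sent n (fun i (x : Bits n) => x i) fun y z => f z y

lemma isMeasurement_ite {A : Type} [Fintype A] [DecidableEq A] (c : Bool) :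
    IsMeasurement fun b : Bool => if c = b then (1 : Matrix A A ℂ) else 0 := by
  cases c <;> simp [IsMeasurement]

/-- A deterministic protocol, run by quantum parties that leave their registers alone. -/
def DetProtocol.toEnt (A B : Type) [Fintype A] [DecidableEq A] [Fintype B] [DecidableEq B] :
    DetProtocol X Y → EntProtocol X Y A B
  | .leaf v => .done (fun _ b => if v = b then 1 else 0) (fun _ => isMeasurement_ite v)
      (fun _ b => if v = b then 1 else 0) (fun _ => isMeasurement_ite v)
  | .alice msg next => .alice A (fun x b => if msg x = b then 1 else 0)
      (fun x => isMeasurement_ite (msg x)) fun b => (next b).toEnt A B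
  | .bob msg next => .bob B (fun y b => if msg y = b then 1 else 0)
      (fun y => isMeasurement_ite (msg y)) fun b => (next b).toEnt A B

variable {A B : Type} [Fintype A] [DecidableEq A] [Fintype B] [DecidableEq B]

lemma DetProtocol.cost_toEnt (p : DetProtocol X Y) : (p.toEnt A B).cost = p.cost := by
  induction p with
  | leaf v => rfl
  | alice msg next ih => simp only [DetProtocol.toEnt, EntProtocol.cost, DetProtocol.cost, ih]
  | bob msg next ih => simp only [DetProtocol.toEnt, EntProtocol.cost, DetProtocol.cost, ih]

/-- In a simulated deterministic protocol, the branch not taken carries the zero state. -/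
lemma EntProtocol.prob_zero (x : X) (y : Y) (v : Bool) (p : EntProtocol X Y A B) :
    p.prob x y v 0 = 0 := by
  induction p with
  | done E hE F hF => simp [EntProtocol.prob, normSq]
  | alice A' K hK next ih => simp [EntProtocol.prob, ih]
  | bob B' L hL next ih => simp [EntProtocol.prob, ih]

lemma DetProtocol.prob_toEnt (p : DetProtocol X Y) (x : X) (y : Y) (ψ : Matrix A B ℂ) :
    (p.toEnt A B).prob x y (p.eval x y) ψ = normSq ψ := by
  induction p with
  | leaf v => simp [DetProtocol.toEnt, EntProtocol.prob, DetProtocol.eval]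
  | alice msg next ih =>
    simp only [DetProtocol.toEnt, EntProtocol.prob, DetProtocol.eval, Fintype.sum_bool]
    have := ih (msg x)
    cases h : msg x <;> rw [h] at this <;> simp [EntProtocol.prob_zero, this]
  | bob msg next ih =>
    simp only [DetProtocol.toEnt, EntProtocol.prob, DetProtocol.eval, Fintype.sum_bool]
    have := ih (msg y)
    cases h : msg y <;> rw [h] at this <;> simp [EntProtocol.prob_zero, this]

/-- The isometry that writes the bit `c i`, computed from the basis state `i`, to a fresh qubit. -/
def writeBit (c : A → Bool) : Matrix (A × Bool) A ℂ :=
  Matrix.of fun i j => if i = (j, c j) then 1 else 0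

lemma isIsometry_writeBit (c : A → Bool) : IsIsometry (writeBit c) := by
  ext i j
  simp only [writeBit, Matrix.mul_apply, Matrix.conjTranspose_apply, Matrix.of_apply,
    Matrix.one_apply]
  rw [Finset.sum_eq_single (i, c i)]
  · by_cases h : i = j <;> simp [h]
  · intro b _ hb; simp [hb]
  · simp

lemma writeBit_mul_apply {C : Type} (c : A → Bool) (ψ : Matrix A C ℂ) (a : A) (d : Bool) (b : C) :
    (writeBit c * ψ) (a, d) b = if d = c a then ψ a b else 0 := by
  simp only [writeBit, Matrix.mul_apply, Matrix.of_apply]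
  rw [Finset.sum_eq_single a] <;> simp +contextual [Prod.ext_iff, eq_comm]

lemma mul_writeBit_transpose_apply {C : Type} (c : B → Bool) (ψ : Matrix C B ℂ) (a : C)
    (d : Bool) (b : B) :
    (ψ * (writeBit c)ᵀ) a (b, d) = if d = c b then ψ a b else 0 := by
  have h := writeBit_mul_apply c ψᵀ b d a
  rw [← Matrix.transpose_apply (writeBit c * ψᵀ), Matrix.transpose_mul,
    Matrix.transpose_transpose] at h
  exact h

/-- The projective measurement of the bit `c i`, computed from the basis state `i`. -/
def readBit (c : A → Bool) (v : Bool) : Matrix A A ℂ :=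
  Matrix.diagonal fun i => if c i = v then 1 else 0

lemma isMeasurement_readBit (c : A → Bool) : IsMeasurement (readBit c) := by
  simp only [IsMeasurement, readBit, Matrix.diagonal_conjTranspose, Matrix.diagonal_mul_diagonal,
    Matrix.diagonal_add]
  rw [← Matrix.diagonal_one]
  congr 1; ext i
  by_cases h : c i <;> simp [h]

lemma readBit_mul_mul_readBit {c : A → Bool} {d : B → Bool} {v : Bool} {φ : Matrix A B ℂ}
    (h : ∀ a b, φ a b ≠ 0 → c a = v ∧ d b = v) : readBit c v * φ * (readBit d v)ᵀ = φ := by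
  ext a b
  simp only [readBit, Matrix.diagonal_transpose, Matrix.mul_diagonal, Matrix.diagonal_mul]
  by_cases h0 : φ a b = 0
  · simp [h0]
  · simp [h a b h0]

/-- The condition on the support of `ψ` is the invariant of the induction: the bits already sent sit
in Bob's basis state `b`, so that `h b y` needs only the remaining ones. -/
lemma exists_qProtocol_of_sent (f : X → Y → Bool) (l : ℕ) (m : Fin l → X → Bool)
    {A B : Type} [Fintype A] [DecidableEq A] [Fintype B] [DecidableEq B]
    (h : B → Y → (Fin l → Bool) → Bool) :
    ∃ p : QProtocol X Y A B, ∀ x y ψ, normSq ψ = 1 →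
      (∀ a b, ψ a b ≠ 0 → h b y (fun i => m i x) = f x y) → p.prob x y (f x y) ψ = 1 := by
  induction l generalizing B with
  | zero =>
    -- Bob sends a copy of the answer and keeps `b`, from which he can read the answer again.
    refine ⟨.bob B (fun y => writeBit fun b => h b y Fin.elim0) (fun y => isIsometry_writeBit _)
      (.done (fun _ => readBit Prod.snd) (fun _ => isMeasurement_readBit _)
        (fun y => readBit fun b => h b y Fin.elim0) (fun y => isMeasurement_readBit _)),
      fun x y ψ hn hψ => ?_⟩
    simp only [QProtocol.prob]
    have hz : (fun i => m i x) = Fin.elim0 := by ext i; exact i.elim0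
    rw [hz] at hψ
    rw [readBit_mul_mul_readBit, normSq_toAlice, (isIsometry_writeBit _).normSq_mul_right, hn]
    rintro ⟨a, c⟩ b hab
    simp only [toAlice, Matrix.of_apply, mul_writeBit_transpose_apply, ne_eq, ite_eq_right_iff,
      Classical.not_imp] at hab
    exact ⟨hab.1.trans (hψ a b hab.2), hψ a b hab.2⟩
  | succ l ih =>
    obtain ⟨p, hp⟩ := ih (fun i => m i.succ) (B := B × Bool)
      fun b y z => h b.1 y (Fin.cons b.2 z)
    refine ⟨.alice A (fun x => writeBit fun _ => m 0 x) (fun x => isIsometry_writeBit _) p,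
      fun x y ψ hn hψ => ?_⟩
    simp only [QProtocol.prob]
    refine hp x y _ ?_ fun a b hab => ?_
    · rw [normSq_toBob, (isIsometry_writeBit _).normSq_mul, hn]
    · obtain ⟨b, c⟩ := b
      simp only [toBob, Matrix.of_apply, writeBit_mul_apply, ne_eq, ite_eq_right_iff,
        Classical.not_imp] at hab
      rw [← hψ a b hab.2, hab.1]
      congr 1; ext i
      refine Fin.cases ?_ (fun j => ?_) i <;> simp

lemma exists_qProtocol {n : ℕ} (f : Bits n → Y → Bool) (k : ℕ) :
    ∃ p : QProtocol (Bits n) Y (Bits k) (Bits k), ∀ x y, p.prob x y (f x y) (epr k) = 1 := by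
  obtain ⟨p, hp⟩ := exists_qProtocol_of_sent f n (fun i (x : Bits n) => x i) (A := Bits k) (B := Bits k)
    fun _ y z => f z y
  exact ⟨p, fun x y => hp x y _ (normSq_epr k) fun _ _ _ => rfl⟩

lemma exists_cost_eq_D {n : ℕ} (f : Bits n → Y → Bool) :
    ∃ p : DetProtocol (Bits n) Y, (∀ x y, p.eval x y = f x y) ∧ p.cost = D f := by
  obtain ⟨p, hp⟩ := exists_detProtocol f
  have hne : {l : ℕ | ∃ p : DetProtocol (Bits n) Y,
      (∀ x y, p.eval x y = f x y) ∧ p.cost = l}.Nonempty := ⟨_, p, hp, rfl⟩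
  exact Nat.sInf_mem hne

lemma exists_cost_eq_Cstar {n : ℕ} (f : Bits n → Y → Bool) :
    ∃ (k : ℕ) (p : EntProtocol (Bits n) Y (Bits k) (Bits k)),
      (∀ x y, p.prob x y (f x y) (epr k) = 1) ∧ p.cost = Cstar f := by
  obtain ⟨p, hp⟩ := exists_detProtocol f
  have hne : {l : ℕ | ∃ (k : ℕ) (p : EntProtocol (Bits n) Y (Bits k) (Bits k)),
      (∀ x y, p.prob x y (f x y) (epr k) = 1) ∧ p.cost = l}.Nonempty :=
    ⟨_, 0, p.toEnt _ _, fun x y => by rw [← hp, p.prob_toEnt, normSq_epr], rfl⟩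
  exact Nat.sInf_mem hne

lemma exists_cost_eq_Qstar {n : ℕ} (f : Bits n → Y → Bool) :
    ∃ (k : ℕ) (p : QProtocol (Bits n) Y (Bits k) (Bits k)),
      (∀ x y, p.prob x y (f x y) (epr k) = 1) ∧ p.cost = Qstar f := by
  obtain ⟨p, hp⟩ := exists_qProtocol f 0
  have hne : {l : ℕ | ∃ (k : ℕ) (p : QProtocol (Bits n) Y (Bits k) (Bits k)),
      (∀ x y, p.prob x y (f x y) (epr k) = 1) ∧ p.cost = l}.Nonempty := ⟨_, 0, p, hp, rfl⟩
  exact Nat.sInf_mem hne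

lemma Cstar_le_D {n : ℕ} (f : Bits n → Y → Bool) : Cstar f ≤ D f := by
  obtain ⟨p, hp, hc⟩ := exists_cost_eq_D f
  refine Nat.sInf_le ⟨0, p.toEnt _ _, fun x y => ?_, p.cost_toEnt.trans hc⟩
  rw [← hp, p.prob_toEnt, normSq_epr]

end

/-! ### The spectrum of the Hamming distance matrix -/

section
variable {n : ℕ}

/-- The character of the group of bit strings that belongs to the set `s`. -/
def character (s : Finset (Fin n)) (x : Bits n) : ℂ := ∏ i ∈ s, if x i then -1 else 1

/-- The sum factors over the coordinates; a coordinate in exactly one of the sets contributes `1 - 1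
= 0`. -/
lemma sum_character_mul (s t : Finset (Fin n)) :
    ∑ x, character s x * character t x = if s = t then 2 ^ n else 0 := by
  let g : Fin n → Bool → ℂ := fun i b =>
    (if i ∈ s then (if b then -1 else 1) else 1) * (if i ∈ t then (if b then -1 else 1) else 1)
  have h1 : ∀ x : Bits n, character s x * character t x = ∏ i, g i (x i) := by
    intro x
    simp only [g, character, Finset.prod_mul_distrib, Finset.prod_ite_mem, Finset.univ_inter]
  have h2 : ∀ i, ∑ b, g i b = if i ∈ s ↔ i ∈ t then 2 else 0 := by
    intro i
    by_cases hs : i ∈ s <;> by_cases ht : i ∈ t <;> simp [g, hs, ht, one_add_one_eq_two]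
  simp only [h1]
  rw [← Fintype.prod_sum, Finset.prod_congr rfl fun i _ => h2 i]
  by_cases hst : s = t
  · simp [hst]
  · rw [if_neg hst]
    obtain ⟨i, hi⟩ := not_forall.1 (mt Finset.ext hst)
    exact Finset.prod_eq_zero (Finset.mem_univ i) (if_neg hi)

lemma character_xor (s : Finset (Fin n)) (x z : Bits n) :
    character s (fun i => xor (x i) (z i)) = character s x * character s z := by
  simp only [character, ← Finset.prod_mul_distrib]
  refine Finset.prod_congr rfl fun i _ => ?_
  by_cases hx : x i <;> by_cases hz : z i <;> simp [hx, hz]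

/-- The number of sets of at most `a` among `n` elements that contain `k` given elements. -/
def ballCount (n a k : ℕ) : ℕ :=
  ∑ m ∈ Finset.range (n - k + 1), if m + k ≤ a then (n - k).choose m else 0

lemma ballCount_eq_zero {n a k : ℕ} (h : a < k) : ballCount n a k = 0 :=
  Finset.sum_eq_zero fun m _ => if_neg (by omega)

/-- This also holds for `a > n`, by truncated subtraction, and keeps the leading coefficient of
`eigenvaluePoly` nonzero in every case. -/
lemma ballCount_self (n a : ℕ) : ballCount n a a = 1 := by
  rw [ballCount, Finset.sum_eq_single 0]
  · simp
  · intro m _ hm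
    exact if_neg (by omega)
  · simp

lemma card_filter_superset_le (T : Finset (Fin n)) (a : ℕ) :
    (Finset.univ.filter fun z : Bits n =>
      (∀ i ∈ T, z i = true) ∧ (Finset.univ.filter fun i => z i = true).card ≤ a).card
      = ballCount n a T.card := by
  have h : ballCount n a T.card = (Tᶜ.powerset.filter fun V => V.card + T.card ≤ a).card := by
    rw [Finset.card_filter, Finset.sum_powerset_apply_card
      (fun m => if m + T.card ≤ a then 1 else 0), Finset.card_compl, Fintype.card_fin, ballCount]
    refine Finset.sum_congr rfl fun m _ => ?_
    split_ifs <;> simp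
  rw [h]
  refine Finset.card_bij' (fun z _ => (Finset.univ.filter fun i => z i = true) \ T)
    (fun V _ i => decide (i ∈ V ∪ T)) ?_ ?_ ?_ ?_
  · intro z hz
    simp only [Finset.mem_filter, Finset.mem_univ, true_and] at hz
    have hsub : T ⊆ Finset.univ.filter fun i => z i = true := fun i hi => by simp [hz.1 i hi]
    simp only [Finset.mem_filter, Finset.mem_powerset]
    refine ⟨fun i hi => ?_, ?_⟩
    · simp only [Finset.mem_sdiff] at hi
      simp [hi.2]
    · rw [Finset.card_sdiff_add_card_eq_card hsub]
      exact hz.2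
  · intro V hV
    simp only [Finset.mem_filter, Finset.mem_powerset] at hV
    simp only [Finset.mem_filter, Finset.mem_univ, true_and, decide_eq_true_eq]
    refine ⟨fun i hi => Finset.mem_union_right _ hi, ?_⟩
    rw [Finset.filter_mem_eq_inter, Finset.univ_inter]
    exact (Finset.card_union_le _ _).trans hV.2
  · intro z hz
    simp only [Finset.mem_filter, Finset.mem_univ, true_and] at hz
    ext i
    by_cases hi : i ∈ T
    · simp [hi, hz.1 i hi]
    · simp [hi]
  · intro V hV
    simp only [Finset.mem_filter, Finset.mem_powerset] at hV
    ext i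
    have := @hV.1 i
    simp only [Finset.mem_compl] at this
    simp only [decide_eq_true_eq, Finset.mem_sdiff, Finset.mem_filter, Finset.mem_univ, true_and,
      Finset.mem_union]
    tauto

/-- The polynomial whose value at `k` is the eigenvalue of the Hamming distance matrix at the
characters that belong to the sets of `k` elements. -/
def eigenvaluePoly (n a : ℕ) : Polynomial ℂ :=
  ∑ k ∈ Finset.range (a + 1),
    Polynomial.C ((-2) ^ k * (ballCount n a k : ℂ) / (k.factorial : ℂ)) * descPochhammer ℂ k

lemma natDegree_eigenvaluePoly_le (n a : ℕ) : (eigenvaluePoly n a).natDegree ≤ a := by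
  refine Polynomial.natDegree_sum_le_of_forall_le _ _ fun k hk => ?_
  refine (Polynomial.natDegree_C_mul_le _ _).trans ?_
  rw [descPochhammer_natDegree]
  exact Nat.lt_succ_iff.1 (Finset.mem_range.1 hk)

/-- Only the top falling factorial reaches degree `a`, with coefficient `(-2) ^ a / a!`. -/
lemma eigenvaluePoly_ne_zero (n a : ℕ) : eigenvaluePoly n a ≠ 0 := by
  have h : (eigenvaluePoly n a).coeff a = (-2) ^ a / (a.factorial : ℂ) := by
    rw [eigenvaluePoly, Polynomial.finsetSum_coeff, Finset.sum_range_succ, Finset.sum_eq_zero]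
    · have h1 : (descPochhammer ℂ a).coeff a = 1 := by
        have := monic_descPochhammer ℂ a
        rwa [Polynomial.Monic, Polynomial.leadingCoeff, descPochhammer_natDegree] at this
      rw [Polynomial.coeff_C_mul, h1, ballCount_self]
      simp
    · intro k hk
      rw [Polynomial.coeff_C_mul, Polynomial.coeff_eq_zero_of_natDegree_lt, mul_zero]
      rw [descPochhammer_natDegree]
      exact Finset.mem_range.1 hk
  intro h0
  rw [h0, Polynomial.coeff_zero] at h
  have : (-2 : ℂ) ^ a / (a.factorial : ℂ) ≠ 0 :=
    div_ne_zero (pow_ne_zero _ (by norm_num)) (Nat.cast_ne_zero.2 a.factorial_ne_zero)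
  exact this h.symm

lemma eval_eigenvaluePoly (n a m : ℕ) : (eigenvaluePoly n a).eval (m : ℂ) =
    ∑ k ∈ Finset.range (m + 1), (m.choose k : ℂ) * ((-2) ^ k * (ballCount n a k : ℂ)) := by
  have h1 : (eigenvaluePoly n a).eval (m : ℂ) =
      ∑ k ∈ Finset.range (a + 1), (m.choose k : ℂ) * ((-2) ^ k * (ballCount n a k : ℂ)) := by
    rw [eigenvaluePoly, Polynomial.eval_finsetSum]
    refine Finset.sum_congr rfl fun k _ => ?_
    rw [Polynomial.eval_mul, Polynomial.eval_C, descPochhammer_eval_eq_descFactorial,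
      Nat.descFactorial_eq_factorial_mul_choose]
    have : (k.factorial : ℂ) ≠ 0 := Nat.cast_ne_zero.2 k.factorial_ne_zero
    push_cast
    field_simp
  rw [h1]
  -- The two ranges differ only in vanishing terms: `ballCount` is zero beyond `a`, the binomial
  -- coefficient beyond `m`.
  rcases le_total a m with h | h
  · refine Finset.sum_subset (Finset.range_mono (by omega)) fun k _ hk => ?_
    rw [ballCount_eq_zero (by simpa using hk)]
    simp
  · symm
    refine Finset.sum_subset (Finset.range_mono (by omega)) fun k _ hk => ?_
    rw [Nat.choose_eq_zero_of_lt (by simpa using hk)]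
    simp

/-- Each factor is `1 - 2 z_i`; the product is expanded over subsets. -/
lemma character_eq_sum (s : Finset (Fin n)) (z : Bits n) :
    character s z = ∑ T ∈ s.powerset, (-2) ^ T.card * if ∀ i ∈ T, z i = true then 1 else 0 := by
  have h : character s z = ∏ i ∈ s, (1 + if z i = true then (-2 : ℂ) else 0) := by
    refine Finset.prod_congr rfl fun i _ => ?_
    split_ifs <;> norm_num
  rw [h, Finset.prod_one_add]
  refine Finset.sum_congr rfl fun T _ => ?_
  rw [Finset.prod_ite_zero]
  simp

lemma sum_ball_character (s : Finset (Fin n)) (a : ℕ) :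
    ∑ z : Bits n, (if (Finset.univ.filter fun i => z i = true).card ≤ a then 1 else 0) *
      character s z = (eigenvaluePoly n a).eval (s.card : ℂ) := by
  rw [eval_eigenvaluePoly]
  have h := Finset.sum_powerset_apply_card
    (x := s) fun k => (-2 : ℂ) ^ k * (ballCount n a k : ℂ)
  simp only [nsmul_eq_mul] at h
  rw [← h]
  simp only [character_eq_sum, Finset.mul_sum]
  rw [Finset.sum_comm]
  refine Finset.sum_congr rfl fun T _ => ?_
  rw [← card_filter_superset_le, Finset.card_filter]
  push_cast
  rw [Finset.mul_sum]
  refine Finset.sum_congr rfl fun z _ => ?_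
  rw [mul_left_comm, ite_and, mul_comm (ite _ _ _)]
  split_ifs <;> simp

lemma sum_HAM_mul_character (a : ℕ) (s : Finset (Fin n)) (x : Bits n) :
    ∑ y, (if HAM n a x y then 1 else 0) * character s y =
      (eigenvaluePoly n a).eval (s.card : ℂ) * character s x := by
  -- The substitution `y = x xor z` turns the sum into a convolution, with eigenvalue the ball sum
  -- at the origin.
  have hinv : Function.Involutive fun (z : Bits n) i => xor (x i) (z i) := by
    intro z; ext i; simp
  rw [← Equiv.sum_comp hinv.toPerm, ← sum_ball_character, Finset.sum_mul]
  refine Finset.sum_congr rfl fun z _ => ?_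
  have hd : hammingDist x (fun i => xor (x i) (z i))
      = (Finset.univ.filter fun i => z i = true).card := by
    unfold hammingDist
    congr 1; ext i
    by_cases hx : x i <;> by_cases hz : z i <;> simp [hx, hz]
  simp only [Function.Involutive.coe_toPerm, HAM, decide_eq_true_eq, hd, character_xor]
  ring

/-! ### Counting the zero eigenvalues -/

lemma card_eigenvalue_eq_zero_le (n a : ℕ) :
    (Finset.univ.filter fun s : Finset (Fin n) =>
      (eigenvaluePoly n a).eval (s.card : ℂ) = 0).card ≤ a * n.choose (n / 2) := by
  classical
  let Z := (Finset.range (n + 1)).filter fun k : ℕ => (eigenvaluePoly n a).eval (k : ℂ) = 0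
  have hZ : Z.card ≤ a := by
    rw [← Finset.card_image_of_injective Z (Nat.cast_injective (R := ℂ))]
    calc (Z.image Nat.cast).card ≤ (eigenvaluePoly n a).roots.toFinset.card := by
          refine Finset.card_le_card fun c hc => ?_
          obtain ⟨k, hk, rfl⟩ := Finset.mem_image.1 hc
          rw [Multiset.mem_toFinset, Polynomial.mem_roots (eigenvaluePoly_ne_zero n a)]
          exact (Finset.mem_filter.1 hk).2
      _ ≤ Multiset.card (eigenvaluePoly n a).roots := Multiset.toFinset_card_le _
      _ ≤ (eigenvaluePoly n a).natDegree := Polynomial.card_roots' _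
      _ ≤ a := natDegree_eigenvaluePoly_le n a
  calc _ ≤ (Z.biUnion fun k => Finset.powersetCard k (Finset.univ : Finset (Fin n))).card := by
        refine Finset.card_le_card fun s hs => ?_
        simp only [Finset.mem_filter, Finset.mem_univ, true_and] at hs
        refine Finset.mem_biUnion.2 ⟨s.card, ?_, by simp⟩
        exact Finset.mem_filter.2
          ⟨Finset.mem_range.2 (Nat.lt_succ_of_le (by simpa using s.card_le_univ)), hs⟩
    _ ≤ Z.card * n.choose (n / 2) := by
        refine Finset.card_biUnion_le_card_mul _ _ _ fun k _ => ?_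
        rw [Finset.card_powersetCard, Finset.card_univ, Fintype.card_fin]
        exact Nat.choose_le_middle k n
    _ ≤ _ := Nat.mul_le_mul_right _ hZ

/-- Induction by the recurrence of the central binomials and `(2m + 1)(2m + 3) ≤ 4(m + 1)²`. -/
lemma sq_centralBinom_mul_le (m : ℕ) : m.centralBinom ^ 2 * (2 * m + 1) ≤ 16 ^ m := by
  induction m with
  | zero => simp
  | succ m ih =>
    have h := Nat.succ_mul_centralBinom_succ m
    refine Nat.le_of_mul_le_mul_left ?_ (show 0 < (m + 1) ^ 2 by positivity)
    calc (m + 1) ^ 2 * ((m + 1).centralBinom ^ 2 * (2 * (m + 1) + 1))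
        = ((m + 1) * (m + 1).centralBinom) ^ 2 * (2 * m + 3) := by ring
      _ = 4 * ((2 * m + 1) * (2 * m + 3)) * (m.centralBinom ^ 2 * (2 * m + 1)) := by
          rw [h]; ring
      _ ≤ 4 * (4 * (m + 1) ^ 2) * 16 ^ m := by
          refine Nat.mul_le_mul (Nat.mul_le_mul_left 4 ?_) ih
          nlinarith
      _ = (m + 1) ^ 2 * 16 ^ (m + 1) := by ring

lemma sq_choose_half_mul_le (n : ℕ) : n.choose (n / 2) ^ 2 * (n + 1) ≤ 4 ^ n := by
  obtain ⟨m, rfl | rfl⟩ := n.even_or_odd'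
  · have h := sq_centralBinom_mul_le m
    rw [Nat.centralBinom] at h
    rw [Nat.mul_div_cancel_left m two_pos, pow_mul]
    exact h
  · have h := sq_centralBinom_mul_le (m + 1)
    -- An odd row is reduced to the next even row, whose middle entry is twice as large.
    have h2 : (m + 1).centralBinom = 2 * (2 * m + 1).choose m := by
      rw [Nat.centralBinom, show 2 * (m + 1) = 2 * m + 1 + 1 by ring, Nat.choose_succ_succ,
        Nat.choose_symm_half]
      ring
    rw [h2] at h
    rw [show (2 * m + 1) / 2 = m by omega]
    have h4 : (4 : ℕ) ^ (2 * m + 1) * 4 = 16 ^ (m + 1) := by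
      rw [← pow_succ, show 2 * m + 1 + 1 = 2 * (m + 1) by ring, pow_mul]; norm_num
    nlinarith [Nat.zero_le ((2 * m + 1).choose m ^ 2)]

lemma two_pow_lt_card_eigenvalue_ne_zero {n a : ℕ} (h : 4 * a ^ 2 ≤ n) :
    2 ^ n < 2 * Fintype.card
      {s : Finset (Fin n) // (eigenvaluePoly n a).eval (s.card : ℂ) ≠ 0} := by
  have h1 := card_eigenvalue_eq_zero_le n a
  have h2 : 2 * (a * n.choose (n / 2)) < 2 ^ n := by
    refine lt_of_pow_lt_pow_left₀ 2 (by positivity) ?_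
    have h3 := sq_choose_half_mul_le n
    have h4 : 0 < n.choose (n / 2) ^ 2 := pow_pos (Nat.choose_pos (Nat.div_le_self n 2)) 2
    calc (2 * (a * n.choose (n / 2))) ^ 2 = n.choose (n / 2) ^ 2 * (4 * a ^ 2) := by ring
      _ < n.choose (n / 2) ^ 2 * (n + 1) := Nat.mul_lt_mul_of_pos_left (by omega) h4
      _ ≤ (2 ^ n) ^ 2 := by rw [← pow_mul, mul_comm n 2, pow_mul]; exact h3
  have h5 := Finset.card_filter_add_card_filter_not (s := (Finset.univ : Finset (Finset (Fin n))))
    (fun s => (eigenvaluePoly n a).eval (s.card : ℂ) = 0)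
  rw [Finset.card_univ, Fintype.card_finset, Fintype.card_fin] at h5
  rw [Fintype.card_subtype]
  simp only [ne_eq]
  omega

lemma HasAcceptanceRankLE.two_pow_lt {a k r : ℕ}
    {P : Bits n → Bits n → Bool → Matrix (Bits k) (Bits k) ℂ → ℝ} (hP : HasAcceptanceRankLE P r)
    (hg : ∀ x y, P x y (HAM n a x y) (epr k) = 1) (h : 4 * a ^ 2 ≤ n) : 2 ^ n < 2 * r := by
  refine (two_pow_lt_card_eigenvalue_ne_zero h).trans_le (Nat.mul_le_mul_left 2 ?_)
  refine hP.card_le hg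
    -- Restricted to the characters with nonzero eigenvalue, the matrix is diagonal; the weight
    -- inverts the eigenvalue and the squared norm `2 ^ n` of a character.
    (fun s x => ((eigenvaluePoly n a).eval (s.1.card : ℂ) * 2 ^ n)⁻¹ * character s.1 x)
    (fun y s => character s.1 y) fun s t => ?_
  simp only [mul_assoc, ← Finset.mul_sum, sum_HAM_mul_character]
  simp only [mul_left_comm (character s.1 _), ← Finset.mul_sum, sum_character_mul]
  by_cases hst : s = t
  · subst hst
    have := s.2
    simp only [if_true]
    field_simp
  · rw [if_neg hst, if_neg fun h' => hst (Subtype.ext h')]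
    simp

end
end CommComplexity
end

theorem theorem3p8 :
    ∃ c : ℝ, 0 < c ∧ ∀ n a : ℕ, (a : ℝ) ≤ c * Real.sqrt n →
      n ≤ CommComplexity.D (CommComplexity.HAM n a) ∧
      (n : ℝ) / 2 ≤ (CommComplexity.Qstar (CommComplexity.HAM n a) : ℝ) ∧
      n ≤ CommComplexity.Cstar (CommComplexity.HAM n a) := by
  -- The constant `1 / 2` is what gives `4 * a ^ 2 ≤ n`.
  refine ⟨1 / 2, by norm_num, fun n a ha => ?_⟩
  have h : 4 * a ^ 2 ≤ n := by
    have h1 : (2 * a : ℝ) ≤ Real.sqrt n := by linarith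
    have h2 := (Real.le_sqrt (by positivity) (by positivity)).1 h1
    have h3 : (4 * a ^ 2 : ℝ) ≤ n := by linarith [h2, mul_pow (2 : ℝ) (a : ℝ) 2]
    exact_mod_cast h3
  have hC : n ≤ CommComplexity.Cstar (CommComplexity.HAM n a) := by
    obtain ⟨k, p, hp, hc⟩ := CommComplexity.exists_cost_eq_Cstar (CommComplexity.HAM n a)
    have := p.hasAcceptanceRankLE.two_pow_lt hp h
    -- The strict inequality `2 ^ n < 2 ^ (Cstar + 1)` yields `n` rather than `n - 1`.
    rw [hc, ← pow_succ'] at this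
    exact Nat.lt_succ_iff.1 ((Nat.pow_lt_pow_iff_right one_lt_two).1 this)
  refine ⟨hC.trans (CommComplexity.Cstar_le_D _), ?_, hC⟩
  obtain ⟨k, p, hp, hc⟩ := CommComplexity.exists_cost_eq_Qstar (CommComplexity.HAM n a)
  have := p.hasAcceptanceRankLE.two_pow_lt hp h
  rw [hc, show (4 : ℕ) = 2 ^ 2 by norm_num, ← pow_mul, ← pow_succ'] at this
  have h' := Nat.lt_succ_iff.1 ((Nat.pow_lt_pow_iff_right one_lt_two).1 this)
  have h'' : (n : ℝ) ≤ 2 * (CommComplexity.Qstar (CommComplexity.HAM n a) : ℝ) := by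
    exact_mod_cast h'
  linarith
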